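/- Let $d\ge 3$, let $T_d=(V,E)$ be the $d$-regular tree, where $E$ is the set of directed edges and $\bar e$ is the inverse of $e\in E$, and let $l:E\to\{1,\dots,d\}$ be a legal labelling: $l(e)=l(\bar e)$ for all $e\in E$, and for every $x\in V$ the restriction $l_x$ of $l$ to the set $E(x)$ of edges with origin $x$ is a bijection $E(x)\to\{1,\dots,d\}$. For $F\le S_d$ let $$\mathrm{U}(F)=\{g\in\mathrm{Aut}(T_d)\mid l_{gx}\circ g\circ l_x^{-1}\in F\text{ for all }x\in V\}.$$ For a subgroup $G\le\mathrm{Aut}(T_d)$ let $G^+$ be the subgroup of $G$ generated by the elements $g\in G$ such that $ge=e$ for some $e\in E$ (that is, by the pointwise stabilizers in $G$ of edges). Then, for every $F\le S_d$, the group $\mathrm{U}(F)^+$ is either trivial or simple. If moreover $F$ acts transitively on $\{1,\dots,d\}$ and is generated by its point stabilizers, then $\mathrm{U}(F)^+=\mathrm{U}(F)\cap\mathrm{Aut}(T_d)^+$ and $[\mathrm{U}(F):\mathrm{U}(F)^+]=2$. -/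

import Mathlib

namespace BurgerMozes

variable {V : Type*} (T : SimpleGraph V)

/-- `E(x)`: the set of directed edges of `T` with origin `x`. -/
abbrev EdgesFrom (x : V) : Type _ := {e : T.Dart // e.fst = x}

/-- A legal labelling of `T` with `d` colours: a map `l` from directed edges to the set of colours
which restricts to a bijection on `E(x)` for every vertex `x` and satisfies `l (ē) = l e`. -/
structure LegalLabelling (d : ℕ) where
  label : T.Dart → Fin d
  bijective_edgesFrom : ∀ x : V, Function.Bijective (fun e : EdgesFrom T x => label e.1)
  label_symm : ∀ e : T.Dart, label e.symm = label e

variable {T}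

/-- The action of an automorphism of `T` on the directed edges of `T`. -/
def mapEdge (g : T ≃g T) (e : T.Dart) : T.Dart :=
  ⟨(g e.fst, g e.snd), g.map_adj_iff.mpr e.adj⟩

theorem mapEdge_mul (g h : T ≃g T) (e : T.Dart) : mapEdge (g * h) e = mapEdge g (mapEdge h e) :=
  rfl

theorem mapEdge_one (e : T.Dart) : mapEdge (1 : T ≃g T) e = e := rfl

/-- The bijection `E(x) → E(g x)` induced by the automorphism `g`. -/
def edgesFromEquiv (g : T ≃g T) (x : V) : EdgesFrom T x ≃ EdgesFrom T (g x) where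
  toFun e := ⟨mapEdge g e.1, congrArg g e.2⟩
  invFun e := ⟨mapEdge g⁻¹ e.1, by
    change g.symm e.1.fst = x
    rw [e.2]; exact g.symm_apply_apply x⟩
  left_inv e := Subtype.ext (by
    change mapEdge g⁻¹ (mapEdge g e.1) = e.1
    rw [← mapEdge_mul, inv_mul_cancel, mapEdge_one])
  right_inv e := Subtype.ext (by
    change mapEdge g (mapEdge g⁻¹ e.1) = e.1
    rw [← mapEdge_mul, mul_inv_cancel, mapEdge_one])

namespace LegalLabelling

variable {d : ℕ} (l : LegalLabelling T d)

/-- The bijection `l_x : E(x) → {1, …, d}`. -/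
noncomputable def atVertex (x : V) : EdgesFrom T x ≃ Fin d :=
  Equiv.ofBijective (fun e => l.label e.1) (l.bijective_edgesFrom x)

/-- The local permutation `c(g, x) = l_{g x} ∘ g ∘ l_x⁻¹` of `g` at the vertex `x`. -/
noncomputable def localPerm (g : T ≃g T) (x : V) : Equiv.Perm (Fin d) :=
  (l.atVertex x).symm.trans ((edgesFromEquiv g x).trans (l.atVertex (g x)))

theorem localPerm_label (g : T ≃g T) (x : V) (e : EdgesFrom T x) :
    l.localPerm g x (l.label e.1) = l.label (mapEdge g e.1) := by
  have h : l.label e.1 = l.atVertex x e := rfl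
  rw [h]
  simp only [localPerm, Equiv.trans_apply, Equiv.symm_apply_apply]
  rfl

theorem localPerm_one (x : V) : l.localPerm 1 x = 1 := by
  ext i
  obtain ⟨e, rfl⟩ := (l.bijective_edgesFrom x).2 i
  simp only [localPerm_label, mapEdge_one, Equiv.Perm.one_apply]

theorem localPerm_mul (g h : T ≃g T) (x : V) :
    l.localPerm (g * h) x = l.localPerm g (h x) * l.localPerm h x := by
  ext i
  obtain ⟨e, rfl⟩ := (l.bijective_edgesFrom x).2 i
  have := l.localPerm_label g (h x) (edgesFromEquiv h x e)
  simp only [localPerm_label, mapEdge_mul, Equiv.Perm.mul_apply]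
  exact congrArg Fin.val this.symm

/-- The universal group `U(F)`: all automorphisms of `T` all of whose local permutations
lie in `F`. -/
noncomputable def universalGroup (F : Subgroup (Equiv.Perm (Fin d))) : Subgroup (T ≃g T) where
  carrier := {g | ∀ x : V, l.localPerm g x ∈ F}
  one_mem' x := by rw [localPerm_one]; exact F.one_mem
  mul_mem' {g h} hg hh x := by rw [localPerm_mul]; exact F.mul_mem (hg _) (hh _)
  inv_mem' {g} hg x := by
    have h := l.localPerm_mul g g⁻¹ x
    rw [mul_inv_cancel, localPerm_one] at h
    rw [eq_inv_of_mul_eq_one_right h.symm]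
    exact F.inv_mem (hg _)

end LegalLabelling

/-- `G⁺`: the subgroup of `G` generated by the stabilizers in `G` of the (directed) edges of `T`,
that is, by the elements of `G` fixing both endpoints of some edge. -/
def plusSubgroup (G : Subgroup (T ≃g T)) : Subgroup (T ≃g T) :=
  Subgroup.closure {g | g ∈ G ∧ ∃ e : T.Dart, mapEdge g e = e}

theorem plusSubgroup_le (G : Subgroup (T ≃g T)) : plusSubgroup G ≤ G :=
  (Subgroup.closure_le G).mpr fun _ hg => hg.1

end BurgerMozes

/-!
The proof of the first part uses half-trees only: the half-tree `B(x, y)` of an edge `{x, y}` is the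
set of vertices closer to `y` than to `x`. Neither hyperbolic elements nor ends are needed.

*Dynamics.* Say that a group flips half-trees if each half-tree is mapped into its complement by
some element. The group `U(F)` does, since it contains the colour-preserving inversion of every edge
(`LegalLabelling.exists_inversion`). Any two half-trees are nested up to complements, so a group that
flips half-trees maps every half-tree into every other one. Moreover a nontrivial automorphism moves
some half-tree off itself, because `d ≥ 3`. Conjugating, one finds that a nontrivial subgroup
normalised by a group that flips half-trees also flips half-trees (`FlipsHalfTrees.of_normalizes`).
Hence `U(F)⁺` flips half-trees if it is nontrivial, and so does every nontrivial normal subgroup `N`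
of `U(F)⁺`.

*Independence.* As `U(F)` is defined by local conditions, automorphisms in `U(F)` can be glued along
disjoint sets whose boundary edges they fix (`LegalLabelling.exists_glue`). So an element of `U(F)`
that fixes an edge is a product of two elements supported on the half-trees of this edge, and it
remains to show that `N` contains every `g ∈ U(F)` supported on a half-tree `B`. By the flipping
property, `N` has an element `n` for which `B`, `n B`, `n² B`, … are pairwise disjoint. The infinite
product `f` of the conjugates `nᵏ g n⁻ᵏ`, `k ≥ 0`, lies in `U(F)⁺`, and `g = f (n f⁻¹ n⁻¹)` lies in `N`
(`LegalLabelling.mem_of_supported`).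

*Index two.* For all vertices `x`, `y` and every `σ` there is an automorphism mapping `x` to `y` all
of whose local permutations are `σ` (`LegalLabelling.exists_localPerm_eq`). If `F` is generated by
point stabilizers, it follows that `U(F)⁺` contains all vertex stabilizers of `U(F)`. If `F` is also
transitive, then vertices at even distance lie in one orbit of `U(F)⁺`. So `U(F)⁺` consists of the
`g ∈ U(F)` that move vertices by even distances. Elements of `Aut(T)⁺` move vertices by even
distances, and edge inversions do not.
-/

namespace BurgerMozes

variable {V : Type*} {T : SimpleGraph V}

/-! ### Half-trees -/

/-- The half-tree consisting of the vertices closer to `y` than to `x`. It is meant for adjacent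
`x` and `y` in a tree, where it is the component of `y` after removal of the edge `{x, y}`. -/
def halfTree (T : SimpleGraph V) (x y : V) : Set V := {v | T.dist v y < T.dist v x}

theorem dist_map (g : T ≃g T) (v w : V) : T.dist (g v) (g w) = T.dist v w := by
  have key : ∀ (g : T ≃g T) (v w : V), T.Reachable v w → T.dist (g v) (g w) ≤ T.dist v w := by
    intro g v w h
    obtain ⟨p, hp⟩ := h.exists_walk_length_eq_dist
    rw [← hp, ← p.length_map g.toHom]
    exact SimpleGraph.dist_le _
  by_cases h : T.Reachable v w
  · refine le_antisymm (key g v w h) ?_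
    have := key g.symm (g v) (g w) (h.map g.toHom)
    simpa using this
  · rw [SimpleGraph.dist_eq_zero_of_not_reachable h, SimpleGraph.dist_eq_zero_of_not_reachable]
    intro h'
    exact h (by simpa using h'.map g.symm.toHom)

theorem map_mem_halfTree (g : T ≃g T) {x y v : V} :
    g v ∈ halfTree T (g x) (g y) ↔ v ∈ halfTree T x y := by
  simp only [halfTree, Set.mem_ofPred_eq, dist_map]

theorem mem_halfTree_self {x y : V} (h : T.Adj x y) : y ∈ halfTree T x y := by
  simp [halfTree, SimpleGraph.dist_eq_one_iff_adj.mpr h.symm]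

theorem notMem_halfTree_self (x y : V) : x ∉ halfTree T x y := by
  simp [halfTree]

theorem notMem_halfTree (hT : T.IsTree) {x y : V} (h : T.Adj x y) {v : V} :
    v ∉ halfTree T x y ↔ v ∈ halfTree T y x := by
  have := hT.dist_ne_of_adj v h
  simp only [halfTree, Set.mem_ofPred_eq]
  omega

theorem notMem_halfTree_swap {x y v : V} (h : v ∈ halfTree T x y) : v ∉ halfTree T y x := by
  simp only [halfTree, Set.mem_ofPred_eq] at *
  omega

/-- A vertex of a tree has at most one neighbour that is closer to a given vertex `r`. -/
theorem eq_of_adj_of_dist_lt (hT : T.IsTree) {r v w w' : V} (h : T.Adj v w) (h' : T.Adj v w')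
    (hw : T.dist r w < T.dist r v) (hw' : T.dist r w' < T.dist r v) : w = w' := by
  have key : ∀ u, T.Adj v u → T.dist r u < T.dist r v →
      ∃ p : T.Walk r v, p.IsPath ∧ p.penultimate = u := by
    intro u hu hlt
    obtain ⟨p, hp⟩ := hT.connected.exists_walk_length_eq_dist r u
    refine ⟨p.concat hu.symm, SimpleGraph.Walk.isPath_of_length_eq_dist _ ?_, by simp⟩
    rw [SimpleGraph.Walk.length_concat, hp]
    have := hT.dist_eq_dist_add_one_of_adj r hu
    omega
  obtain ⟨p, hp, rfl⟩ := key w h hw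
  obtain ⟨q, hq, rfl⟩ := key w' h' hw'
  rw [(hT.existsUnique_path r v).unique hp hq]

theorem exists_adj_dist_lt (hT : T.IsTree) {r v : V} (h : v ≠ r) :
    ∃ w, T.Adj v w ∧ T.dist w r < T.dist v r := by
  obtain ⟨p, hp⟩ := hT.connected.exists_walk_length_eq_dist v r
  cases p with
  | nil => exact absurd rfl h
  | cons hvw q =>
    refine ⟨_, hvw, ?_⟩
    rw [← hp, SimpleGraph.Walk.length_cons]
    exact Nat.lt_succ_of_le (SimpleGraph.dist_le q)

/-- The edge `{x, y}` is the only one that joins the half-tree to its complement. -/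
theorem eq_of_crossing (hT : T.IsTree) {x y v w : V} (hxy : T.Adj x y) (hvw : T.Adj v w)
    (hv : v ∈ halfTree T x y) (hw : w ∉ halfTree T x y) : v = y ∧ w = x := by
  have hvx := hT.dist_eq_dist_add_one_of_adj v hxy
  have hwx := hT.dist_eq_dist_add_one_of_adj w hxy
  have hxv := hT.dist_eq_dist_add_one_of_adj x hvw
  have hyv := hT.dist_eq_dist_add_one_of_adj y hvw
  simp only [halfTree, Set.mem_ofPred_eq] at hv hw
  simp only [T.dist_comm (u := x) (v := v), T.dist_comm (u := x) (v := w),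
    T.dist_comm (u := y) (v := v), T.dist_comm (u := y) (v := w)] at hxv hyv
  by_cases hvy : v = y
  · subst hvy
    have h0 : T.dist v v = 0 := SimpleGraph.dist_self
    refine ⟨rfl, hT.connected.dist_eq_zero_iff.mp (by omega)⟩
  · -- The next vertex on the way from `v` to `y` is also closer to `x`, so it equals `w`.
    obtain ⟨u, hvu, hu⟩ := exists_adj_dist_lt hT hvy
    have hux := hT.dist_eq_dist_add_one_of_adj u hxy
    have hxu := hT.dist_eq_dist_add_one_of_adj x hvu
    simp only [T.dist_comm (u := x) (v := v), T.dist_comm (u := x) (v := u)] at hxu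
    have : w = u := by
      refine eq_of_adj_of_dist_lt hT (r := x) hvw hvu ?_ ?_ <;>
        rw [T.dist_comm (u := x), T.dist_comm (u := x)] <;> omega
    subst this
    omega

theorem eq_of_mem_halfTree_of_mem_halfTree (hT : T.IsTree) {x y z v : V} (hy : T.Adj x y)
    (hz : T.Adj x z) (hvy : v ∈ halfTree T x y) (hvz : v ∈ halfTree T x z) : y = z :=
  eq_of_adj_of_dist_lt hT hy hz hvy hvz

/-- Half-trees are connected: the path from a vertex of the half-tree to its root `y` stays
inside. -/
theorem halfTree_induction (hT : T.IsTree) {x y : V} (hxy : T.Adj x y) (P : V → Prop) (hy : P y)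
    (step : ∀ v w, T.Adj v w → v ∈ halfTree T x y → w ∈ halfTree T x y → P w → P v) :
    ∀ v ∈ halfTree T x y, P v := by
  intro v
  induction hn : T.dist v y using Nat.strong_induction_on generalizing v with
  | _ n ih =>
    intro hv
    by_cases hvy : v = y
    · exact hvy ▸ hy
    · obtain ⟨u, hvu, hu⟩ := exists_adj_dist_lt hT hvy
      have hmem : u ∈ halfTree T x y := by
        by_contra hcon
        exact hvy (eq_of_crossing hT hxy hvu hv hcon).1
      exact step v u hvu hv hmem (ih _ (hn ▸ hu) u rfl hmem)

theorem halfTree_subset (hT : T.IsTree) {x y u w : V} (hxy : T.Adj x y) (huw : T.Adj u w)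
    (hw : w ∉ halfTree T x y) (hy : y ∈ halfTree T u w) :
    halfTree T x y ⊆ halfTree T u w := by
  refine halfTree_induction hT hxy _ hy fun v v' hvv' hv hv' hP => ?_
  by_contra hcon
  exact hw ((eq_of_crossing hT huw hvv'.symm hP hcon).1 ▸ hv')

/-- Two half-trees are always nested, up to passing to complements. -/
theorem halfTree_nested (hT : T.IsTree) {x y u w : V} (hxy : T.Adj x y) (huw : T.Adj u w) :
    halfTree T x y ⊆ halfTree T u w ∨ halfTree T x y ⊆ halfTree T w u ∨
      halfTree T y x ⊆ halfTree T u w ∨ halfTree T y x ⊆ halfTree T w u := by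
  by_cases hu : u ∈ halfTree T x y <;> by_cases hw : w ∈ halfTree T x y
  · have hu' := notMem_halfTree_swap hu
    have hw' := notMem_halfTree_swap hw
    by_cases hx : x ∈ halfTree T u w
    · exact .inr (.inr (.inl (halfTree_subset hT hxy.symm huw hw' hx)))
    · rw [notMem_halfTree hT huw] at hx
      exact .inr (.inr (.inr (halfTree_subset hT hxy.symm huw.symm hu' hx)))
  · obtain ⟨rfl, rfl⟩ := eq_of_crossing hT hxy huw hu hw
    exact .inr (.inl subset_rfl)
  · obtain ⟨rfl, rfl⟩ := eq_of_crossing hT hxy huw.symm hw hu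
    exact .inl subset_rfl
  · by_cases hy : y ∈ halfTree T u w
    · exact .inl (halfTree_subset hT hxy huw hw hy)
    · rw [notMem_halfTree hT huw] at hy
      exact .inr (.inl (halfTree_subset hT hxy huw.symm hu hy))

/-- Branches at distinct vertices `v` and `u` are disjoint if neither of them contains the origin of
the other. -/
theorem disjoint_halfTree (hT : T.IsTree) {v w u z : V} (hvw : T.Adj v w) (huz : T.Adj u z)
    (hne : u ≠ v) (hu : u ∉ halfTree T v w) (hv : v ∉ halfTree T u z) :
    ∀ t ∈ halfTree T v w, t ∉ halfTree T u z := by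
  have hw : w ∉ halfTree T u z := fun hw =>
    hne (eq_of_crossing hT huz hvw.symm hw hv).2.symm
  rw [notMem_halfTree hT huz] at hw
  exact fun t ht => notMem_halfTree_swap
    (halfTree_subset hT hvw huz.symm hu hw ht)

/-- An automorphism that moves a vertex `v` of degree at least three moves some branch at `v` off
itself: at most one branch at `v` contains `m v`, and at most one branch at `v` is mapped to a
branch at `m v` that contains `v`. -/
theorem exists_halfTree_disjoint_map (hT : T.IsTree) (m : T ≃g T) {v : V} (hm : m v ≠ v)
    (nb : Fin 3 → V) (hadj : ∀ i, T.Adj v (nb i)) (hinj : Function.Injective nb) :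
    ∃ w, T.Adj v w ∧ ∀ t ∈ halfTree T v w, m t ∉ halfTree T v w := by
  have h1 : ∀ i j, m v ∈ halfTree T v (nb i) → m v ∈ halfTree T v (nb j) → i = j :=
    fun i j hi hj => hinj (eq_of_mem_halfTree_of_mem_halfTree hT (hadj i) (hadj j) hi hj)
  have hadj' : ∀ i, T.Adj (m v) (m (nb i)) := fun i => m.map_adj_iff.mpr (hadj i)
  have h2 : ∀ i j, v ∈ halfTree T (m v) (m (nb i)) → v ∈ halfTree T (m v) (m (nb j)) → i = j :=
    fun i j hi hj => hinj (m.injective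
      (eq_of_mem_halfTree_of_mem_halfTree hT (hadj' i) (hadj' j) hi hj))
  obtain ⟨i, hi, hi'⟩ : ∃ i, m v ∉ halfTree T v (nb i) ∧ v ∉ halfTree T (m v) (m (nb i)) := by
    by_contra! hcon
    have a := h1 0 1
    have b := h1 0 2
    have c := h1 1 2
    have a' := h2 0 1
    have b' := h2 0 2
    have c' := h2 1 2
    have e0 := hcon 0
    have e1 := hcon 1
    have e2 := hcon 2
    simp only [Fin.reduceEq, imp_false] at a b c a' b' c'
    tauto
  refine ⟨nb i, hadj i, fun t ht hmt => ?_⟩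
  exact disjoint_halfTree hT (hadj i) (hadj' i) hm hi hi' (m t) hmt ((map_mem_halfTree m).mpr ht)

/-! ### Groups that flip half-trees -/

/-- Every half-tree is mapped into its complement by some element of `H`. -/
def FlipsHalfTrees (H : Subgroup (T ≃g T)) : Prop :=
  ∀ x y, T.Adj x y → ∃ h ∈ H, Set.MapsTo h (halfTree T x y) (halfTree T y x)

theorem FlipsHalfTrees.exists_mapsTo (hT : T.IsTree) {H : Subgroup (T ≃g T)}
    (hH : FlipsHalfTrees H) {x y u w : V} (hxy : T.Adj x y) (huw : T.Adj u w) :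
    ∃ h ∈ H, Set.MapsTo h (halfTree T x y) (halfTree T u w) := by
  obtain ⟨h, hh, hm⟩ := hH x y hxy
  obtain ⟨k, hk, km⟩ := hH w u huw.symm
  rcases halfTree_nested hT hxy huw with hs | hs | hs | hs
  · exact ⟨1, H.one_mem, hs⟩
  · exact ⟨k, hk, km.comp hs⟩
  · exact ⟨h, hh, fun v hv => hs (hm hv)⟩
  · exact ⟨k * h, H.mul_mem hk hh, fun v hv => km (hs (hm hv))⟩

/-- Flipping half-trees is inherited by nontrivial subgroups normalised by the group: if `m` moves
the half-tree `D` off itself and `h` maps the half-tree `B` into `D`, then the conjugate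
`h⁻¹ * m * h` moves `B` off itself. -/
theorem FlipsHalfTrees.of_normalizes (hT : T.IsTree) {H M : Subgroup (T ≃g T)}
    (hH : FlipsHalfTrees H) (hdeg : ∀ v, ∃ nb : Fin 3 → V, (∀ i, T.Adj v (nb i)) ∧
      Function.Injective nb) (hM : M ≠ ⊥) (hHM : ∀ h ∈ H, ∀ m ∈ M, h⁻¹ * m * h ∈ M) :
    FlipsHalfTrees M := by
  intro x y hxy
  obtain ⟨⟨m, hmM⟩, hm1⟩ := Subgroup.ne_bot_iff_exists_ne_one.mp hM
  obtain ⟨v, hv⟩ : ∃ v, m v ≠ v := by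
    by_contra! hcon
    exact hm1 (Subtype.ext (RelIso.ext hcon))
  obtain ⟨nb, hadj, hinj⟩ := hdeg v
  obtain ⟨w, hvw, hD⟩ := exists_halfTree_disjoint_map hT m hv nb hadj hinj
  obtain ⟨h, hh, hB⟩ := hH.exists_mapsTo hT hxy hvw
  refine ⟨h⁻¹ * m * h, hHM h hh m hmM, fun t ht => ?_⟩
  rw [← notMem_halfTree hT hxy]
  intro hcon
  have := hB hcon
  simp only [RelIso.mul_apply, RelIso.apply_inv_self] at this
  exact hD _ (hB ht) this

/-- If `N` flips half-trees, then for every half-tree `B` there are `n ∈ N` and a set `C` disjoint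
from `B` with `n (B ∪ C) ⊆ C`, so that the translates `n ^ k B` are pairwise disjoint. The set `C`
is a second branch at the origin `x` of `B`, and `n` is built from two flips, one into this branch
and one into a third branch. -/
theorem FlipsHalfTrees.exists_wandering (hT : T.IsTree) {N : Subgroup (T ≃g T)}
    (hN : FlipsHalfTrees N) (hdeg : ∀ v, ∃ nb : Fin 3 → V, (∀ i, T.Adj v (nb i)) ∧
      Function.Injective nb) {x y : V} (hxy : T.Adj x y) :
    ∃ n ∈ N, ∃ C : Set V, (∀ v ∈ halfTree T x y, v ∉ C) ∧ (∀ v ∈ halfTree T x y, n v ∈ C) ∧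
      ∀ v ∈ C, n v ∈ C := by
  obtain ⟨y₁, y₂, h₁, h₂, hy₁, hy₂, h₁₂⟩ :
      ∃ y₁ y₂, T.Adj x y₁ ∧ T.Adj x y₂ ∧ y ≠ y₁ ∧ y ≠ y₂ ∧ y₁ ≠ y₂ := by
    obtain ⟨nb, hadj, hinj⟩ := hdeg x
    have h01 := hinj.ne (show (0 : Fin 3) ≠ 1 by decide)
    have h02 := hinj.ne (show (0 : Fin 3) ≠ 2 by decide)
    have h12 := hinj.ne (show (1 : Fin 3) ≠ 2 by decide)
    by_cases e0 : y = nb 0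
    · exact ⟨nb 1, nb 2, hadj 1, hadj 2, e0 ▸ h01, e0 ▸ h02, h12⟩
    by_cases e1 : y = nb 1
    · exact ⟨nb 0, nb 2, hadj 0, hadj 2, e0, e1 ▸ h12, h02⟩
    · exact ⟨nb 0, nb 1, hadj 0, hadj 1, e0, e1, h01⟩
  obtain ⟨k₁, hk₁, m₁⟩ := hN y₁ x h₁.symm
  obtain ⟨k₂, hk₂, m₂⟩ := hN y₂ x h₂.symm
  -- A vertex outside the branch of `y₂` is mapped by `k₂⁻¹` into that branch.
  have m₂' : ∀ v, v ∉ halfTree T x y₂ → k₂⁻¹ v ∈ halfTree T x y₂ := by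
    intro v hv
    by_contra hcon
    rw [notMem_halfTree hT h₂] at hcon
    have := m₂ hcon
    rw [RelIso.apply_inv_self] at this
    exact hv this
  have m : ∀ v, v ∉ halfTree T x y₂ → (k₁ * k₂⁻¹) v ∈ halfTree T x y₁ := by
    intro v hv
    refine m₁ ((notMem_halfTree hT h₁).mp fun hcon => h₁₂ ?_)
    exact eq_of_mem_halfTree_of_mem_halfTree hT h₁ h₂ hcon (m₂' v hv)
  refine ⟨k₁ * k₂⁻¹, N.mul_mem hk₁ (N.inv_mem hk₂), halfTree T x y₁, ?_, ?_, ?_⟩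
  · exact fun v hv hv₁ => hy₁ (eq_of_mem_halfTree_of_mem_halfTree hT hxy h₁ hv hv₁)
  · exact fun v hv => m v fun hv₂ => hy₂ (eq_of_mem_halfTree_of_mem_halfTree hT hxy h₂ hv hv₂)
  · exact fun v hv => m v fun hv₂ => h₁₂ (eq_of_mem_halfTree_of_mem_halfTree hT h₁ h₂ hv hv₂)

/-! ### Gluing automorphisms -/

open Classical in
/-- The map that agrees with `g i` on `S i` and is the identity outside all of the sets `S i`;
it is meant for pairwise disjoint sets. -/
noncomputable def glue {ι : Type*} (S : ι → Set V) (g : ι → T ≃g T) (v : V) : V :=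
  if h : ∃ i, v ∈ S i then g h.choose v else v

section Glue

variable {ι : Type*} {S : ι → Set V} {g : ι → T ≃g T}

theorem glue_of_mem (hS : ∀ i j v, v ∈ S i → v ∈ S j → i = j) {i : ι} {v : V} (hv : v ∈ S i) :
    glue S g v = g i v := by
  have h : ∃ i, v ∈ S i := ⟨i, hv⟩
  rw [glue, dif_pos h, hS _ _ v h.choose_spec hv]

theorem glue_of_notMem {v : V} (hv : ∀ i, v ∉ S i) : glue S g v = v := by
  rw [glue, dif_neg (by simpa using hv)]

/-- If each `g i` fixes the boundary edges of `S i`, then the glued map coincides near every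
vertex with the identity or with one of the automorphisms `g i`. -/
theorem glue_local (hS : ∀ i j v, v ∈ S i → v ∈ S j → i = j)
    (hb : ∀ i v w, T.Adj v w → v ∈ S i → w ∉ S i → g i v = v ∧ g i w = w) (v : V) :
    ∃ h : T ≃g T, (h = 1 ∨ ∃ i, h = g i) ∧ glue S g v = h v ∧ ∀ w, T.Adj v w → glue S g w = h w := by
  by_cases hv : ∃ i, v ∈ S i
  · obtain ⟨i, hi⟩ := hv
    refine ⟨g i, .inr ⟨i, rfl⟩, glue_of_mem hS hi, fun w hvw => ?_⟩
    by_cases hw : w ∈ S i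
    · exact glue_of_mem hS hw
    rw [(hb i v w hvw hi hw).2]
    by_cases hw' : ∃ j, w ∈ S j
    · obtain ⟨j, hj⟩ := hw'
      rw [glue_of_mem hS hj]
      exact (hb j w v hvw.symm hj fun hvj => hw (hS i j v hi hvj ▸ hj)).1
    · exact glue_of_notMem (by simpa using hw')
  · simp only [not_exists] at hv
    refine ⟨1, .inl rfl, glue_of_notMem hv, fun w hvw => ?_⟩
    by_cases hw' : ∃ j, w ∈ S j
    · obtain ⟨j, hj⟩ := hw'
      rw [glue_of_mem hS hj]
      exact (hb j w v hvw.symm hj (hv j)).1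
    · exact glue_of_notMem (by simpa using hw')

theorem glue_leftInverse (hS : ∀ i j v, v ∈ S i → v ∈ S j → i = j)
    (hg : ∀ i v, g i v ∈ S i ↔ v ∈ S i) :
    Function.LeftInverse (glue S fun i => (g i)⁻¹) (glue S g) := by
  intro v
  by_cases hv : ∃ i, v ∈ S i
  · obtain ⟨i, hi⟩ := hv
    rw [glue_of_mem hS hi, glue_of_mem hS ((hg i v).mpr hi), RelIso.inv_apply_self]
  · simp only [not_exists] at hv
    rw [glue_of_notMem hv, glue_of_notMem hv]

end Glue

theorem LegalLabelling.localPerm_congr {d : ℕ} (l : LegalLabelling T d) {f g : T ≃g T} {v : V}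
    (hv : f v = g v) (hw : ∀ w, T.Adj v w → f w = g w) : l.localPerm f v = l.localPerm g v := by
  ext i
  obtain ⟨e, rfl⟩ := (l.bijective_edgesFrom v).2 i
  have : mapEdge f e.1 = mapEdge g e.1 := by
    obtain ⟨e, rfl⟩ := e
    exact SimpleGraph.Dart.ext _ _ (Prod.ext hv (hw _ e.adj))
  simp only [LegalLabelling.localPerm_label, this]

/-- The universal group is defined by local conditions, so it contains the automorphisms glued from
its elements along disjoint sets. For half-trees this is Tits' independence property. -/
theorem LegalLabelling.exists_glue {d : ℕ} (l : LegalLabelling T d)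
    (F : Subgroup (Equiv.Perm (Fin d))) {ι : Type*} {S : ι → Set V} {g : ι → T ≃g T}
    (hF : ∀ i, g i ∈ l.universalGroup F)
    (hS : ∀ i j v, v ∈ S i → v ∈ S j → i = j) (hg : ∀ i v, g i v ∈ S i ↔ v ∈ S i)
    (hb : ∀ i v w, T.Adj v w → v ∈ S i → w ∉ S i → g i v = v ∧ g i w = w) :
    ∃ f ∈ l.universalGroup F, (∀ i v, v ∈ S i → f v = g i v) ∧
      ∀ v, (∀ i, v ∉ S i) → f v = v := by
  have hg' : ∀ i v, (g i)⁻¹ v ∈ S i ↔ v ∈ S i := fun i v => by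
    rw [← hg i, RelIso.apply_inv_self]
  have hb' : ∀ i v w, T.Adj v w → v ∈ S i → w ∉ S i → (g i)⁻¹ v = v ∧ (g i)⁻¹ w = w := by
    intro i v w h hv hw
    obtain ⟨h1, h2⟩ := hb i v w h hv hw
    constructor
    · conv_lhs => rw [← h1, RelIso.inv_apply_self]
    · conv_lhs => rw [← h2, RelIso.inv_apply_self]
  have hl := glue_leftInverse (g := g) hS hg
  have hr : Function.LeftInverse (glue S g) (glue S fun i => (g i)⁻¹) := by
    simpa using glue_leftInverse (g := fun i => (g i)⁻¹) hS hg'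
  have adj : ∀ k : ι → T ≃g T,
      (∀ i v w, T.Adj v w → v ∈ S i → w ∉ S i → k i v = v ∧ k i w = w) →
      ∀ v w, T.Adj v w → T.Adj (glue S k v) (glue S k w) := by
    intro k hk v w hvw
    obtain ⟨h, -, h1, h2⟩ := glue_local hS hk v
    rw [h1, h2 w hvw]
    exact h.map_adj_iff.mpr hvw
  let f : T ≃g T :=
    { toFun := glue S g
      invFun := glue S fun i => (g i)⁻¹
      left_inv := hl
      right_inv := hr
      map_rel_iff' := by
        intro v w
        refine ⟨fun h => ?_, adj g hb v w⟩
        have := adj _ hb' _ _ h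
        simp only [Equiv.coe_fn_mk] at this
        rwa [hl, hl] at this }
  refine ⟨f, fun v => ?_, fun i v hv => glue_of_mem hS hv, fun v hv => glue_of_notMem hv⟩
  obtain ⟨h, hh, h1, h2⟩ := glue_local hS hb v
  rw [l.localPerm_congr (f := f) (g := h) h1 h2]
  rcases hh with rfl | ⟨i, rfl⟩
  · exact (l.universalGroup F).one_mem v
  · exact hF i v

/-! ### Simplicity -/

theorem mem_plusSubgroup {G : Subgroup (T ≃g T)} {g : T ≃g T} (hg : g ∈ G) {x y : V}
    (hxy : T.Adj x y) (hx : g x = x) (hy : g y = y) : g ∈ plusSubgroup G :=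
  Subgroup.subset_closure ⟨hg, ⟨(x, y), hxy⟩, SimpleGraph.Dart.ext _ _ (Prod.ext hx hy)⟩

theorem conj_mem_plusSubgroup {G : Subgroup (T ≃g T)} {g h : T ≃g T} (hg : g ∈ G)
    (hh : h ∈ plusSubgroup G) : g⁻¹ * h * g ∈ plusSubgroup G := by
  induction hh using Subgroup.closure_induction with
  | mem h hh =>
    obtain ⟨hG, e, he⟩ := hh
    refine Subgroup.subset_closure
      ⟨G.mul_mem (G.mul_mem (G.inv_mem hg) hG) hg, mapEdge g⁻¹ e, ?_⟩
    rw [← mapEdge_mul, mul_assoc, mul_inv_cancel, mul_one, mapEdge_mul, he]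
  | one => simp
  | mul a b _ _ ha hb => simpa [mul_assoc] using Subgroup.mul_mem _ ha hb
  | inv a _ ha => simpa [mul_assoc] using Subgroup.inv_mem _ ha

/-- An element `g` supported on a half-tree `B` is a commutator `f * (n * f⁻¹ * n⁻¹)` of an element
`n` whose powers move `B` to disjoint half-trees, where `f` is the infinite product of the
conjugates `n ^ k * g * n ^ (-k)`. -/
theorem LegalLabelling.mem_of_supported {d : ℕ} (l : LegalLabelling T d)
    (F : Subgroup (Equiv.Perm (Fin d))) (hT : T.IsTree) {N : Subgroup (T ≃g T)}
    (hN : FlipsHalfTrees N) (hdeg : ∀ v, ∃ nb : Fin 3 → V, (∀ i, T.Adj v (nb i)) ∧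
      Function.Injective nb) (hle : N ≤ l.universalGroup F)
    (hnorm : ∀ h ∈ plusSubgroup (l.universalGroup F), ∀ n ∈ N, h⁻¹ * n * h ∈ N)
    {g : T ≃g T} (hg : g ∈ l.universalGroup F) {x y : V} (hxy : T.Adj x y) (hgy : g y = y)
    (hgB : ∀ v, v ∉ halfTree T x y → g v = v) : g ∈ N := by
  obtain ⟨n, hn, C, hBC, hnB, hnC⟩ := hN.exists_wandering hT hdeg hxy
  have hgx : g x = x := hgB x (notMem_halfTree_self x y)
  have hpow : ∀ k : ℕ, ∀ v ∈ halfTree T x y, (n ^ (k + 1)) v ∈ C := by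
    intro k v hv
    induction k with
    | zero => simpa using hnB v hv
    | succ k ih => rw [pow_succ']; exact hnC _ ih
  let S : ℕ → Set V := fun k => {v | (n ^ k)⁻¹ v ∈ halfTree T x y}
  let c : ℕ → T ≃g T := fun k => n ^ k * g * (n ^ k)⁻¹
  have hSlt : ∀ i k v, v ∈ S i → v ∉ S (i + (k + 1)) := by
    intro i k v hi hk
    have := hpow k _ hk
    rw [← RelIso.mul_apply, pow_add n i (k + 1), mul_inv_rev, mul_inv_cancel_left] at this
    exact hBC _ hi this
  have hS : ∀ i j v, v ∈ S i → v ∈ S j → i = j := by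
    intro i j v hi hj
    rcases lt_trichotomy i j with h | h | h
    · obtain ⟨k, rfl⟩ := Nat.exists_eq_add_of_lt h
      exact absurd hj (hSlt i k v hi)
    · exact h
    · obtain ⟨k, rfl⟩ := Nat.exists_eq_add_of_lt h
      exact absurd hi (hSlt j k v hj)
  have hgmem : ∀ v, g v ∈ halfTree T x y ↔ v ∈ halfTree T x y := by
    intro v
    have := map_mem_halfTree g (x := x) (y := y) (v := v)
    rwa [hgx, hgy] at this
  have hcS : ∀ k v, c k v ∈ S k ↔ v ∈ S k := by
    intro k v
    simp only [S, c, Set.mem_ofPred_eq, RelIso.mul_apply, RelIso.inv_apply_self, hgmem]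
  obtain ⟨f, hfG, hfS, hf⟩ := l.exists_glue F (S := S) (g := c)
    (fun k => Subgroup.mul_mem _ (Subgroup.mul_mem _ (Subgroup.pow_mem _ (hle hn) k) hg)
      (Subgroup.inv_mem _ (Subgroup.pow_mem _ (hle hn) k))) hS hcS (by
    intro k v w hvw hv hw
    obtain ⟨h1, h2⟩ := eq_of_crossing hT hxy ((n ^ k)⁻¹.map_adj_iff.mpr hvw) hv hw
    simp only [c, RelIso.mul_apply, h1, h2, hgx, hgy]
    rw [← h1, ← h2, RelIso.apply_inv_self, RelIso.apply_inv_self]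
    exact ⟨rfl, rfl⟩)
  have h0 : ∀ v, v ∈ S 0 ↔ v ∈ halfTree T x y := fun v => by simp [S]
  have hfy : f y = y := by
    rw [hfS 0 y ((h0 y).mpr (mem_halfTree_self hxy))]
    simpa [c] using hgy
  -- The edge `{x, y}` leaves the half-tree `S 0`; if it also leaves `S k`, then `c k` fixes it.
  have hfx : f x = x := by
    by_cases hx : ∃ k, x ∈ S k
    · obtain ⟨k, hk⟩ := hx
      have hyk : y ∉ S k := by
        intro hyk
        obtain rfl := hS 0 k y ((h0 y).mpr (mem_halfTree_self hxy)) hyk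
        exact notMem_halfTree_self x y ((h0 x).mp hk)
      obtain ⟨h1, -⟩ := eq_of_crossing hT hxy ((n ^ k)⁻¹.map_adj_iff.mpr hxy) hk hyk
      rw [hfS k x hk]
      simp only [c, RelIso.mul_apply, h1, hgy]
      rw [← h1, RelIso.apply_inv_self]
    · exact hf x (by simpa using hx)
  have hfP := mem_plusSubgroup hfG hxy hfx hfy
  have key : f * n = g * n * f := by
    ext v
    simp only [RelIso.mul_apply]
    by_cases hv : ∃ k, v ∈ S k
    · obtain ⟨k, hk⟩ := hv
      have hk' : ∀ w, w ∈ S k → n w ∈ S (k + 1) := by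
        intro w hw
        simpa [S, pow_succ', mul_inv_rev, RelIso.mul_apply] using hw
      have hck : c k v ∈ S k := (hcS k v).mpr hk
      have hnot : n (c k v) ∉ halfTree T x y := by
        intro hcon
        have := hS 0 (k + 1) _ ((h0 _).mpr hcon) (hk' _ hck)
        omega
      rw [hfS (k + 1) _ (hk' v hk), hfS k v hk, hgB _ hnot]
      simp [c, pow_succ', mul_inv_rev, RelIso.mul_apply]
    · simp only [not_exists] at hv
      rw [hf v hv]
      by_cases hnv : n v ∈ halfTree T x y
      · rw [hfS 0 _ ((h0 _).mpr hnv)]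
        simp [c]
      · rw [hgB _ hnv]
        refine hf _ fun k hk => ?_
        cases k with
        | zero => exact hnv ((h0 _).mp hk)
        | succ k =>
          refine hv k ?_
          simpa [S, pow_succ', mul_inv_rev, RelIso.mul_apply] using hk
  have : g = f⁻¹⁻¹ * n * f⁻¹ * n⁻¹ := by
    rw [inv_inv, key]; group
  rw [this]
  exact N.mul_mem (hnorm _ (Subgroup.inv_mem _ hfP) n hn) (N.inv_mem hn)

/-- By the independence property an element fixing an edge is the product of two elements supported
on the two half-trees of this edge. -/
theorem LegalLabelling.plusSubgroup_le_of_normalizes {d : ℕ} (l : LegalLabelling T d)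
    (F : Subgroup (Equiv.Perm (Fin d))) (hT : T.IsTree) {N : Subgroup (T ≃g T)}
    (hN : FlipsHalfTrees N) (hdeg : ∀ v, ∃ nb : Fin 3 → V, (∀ i, T.Adj v (nb i)) ∧
      Function.Injective nb) (hle : N ≤ l.universalGroup F)
    (hnorm : ∀ h ∈ plusSubgroup (l.universalGroup F), ∀ n ∈ N, h⁻¹ * n * h ∈ N) :
    plusSubgroup (l.universalGroup F) ≤ N := by
  refine (Subgroup.closure_le N).mpr ?_
  rintro g ⟨hg, ⟨⟨x, y⟩, hxy⟩, he⟩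
  have hgx : g x = x := congrArg (fun e : T.Dart => e.fst) he
  have hgy : g y = y := congrArg (fun e : T.Dart => e.snd) he
  replace hxy : T.Adj x y := hxy
  obtain ⟨f, hf, hfB, hfA⟩ := l.exists_glue F (ι := Unit) (S := fun _ => halfTree T x y)
    (g := fun _ => g) (fun _ => hg) (fun _ _ _ _ _ => rfl)
    (fun _ v => by
      have := map_mem_halfTree g (x := x) (y := y) (v := v)
      rwa [hgx, hgy] at this)
    (fun _ v w hvw hv hw => by
      obtain ⟨rfl, rfl⟩ := eq_of_crossing hT hxy hvw hv hw
      exact ⟨hgy, hgx⟩)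
  have hfB : ∀ v ∈ halfTree T x y, f v = g v := hfB ()
  have hfA : ∀ v, v ∉ halfTree T x y → f v = v := fun v hv => hfA v fun _ => hv
  have h1 : f ∈ N := l.mem_of_supported F hT hN hdeg hle hnorm hf hxy
    ((hfB y (mem_halfTree_self hxy)).trans hgy) hfA
  have h2 : f⁻¹ * g ∈ N := by
    refine l.mem_of_supported F hT hN hdeg hle hnorm
      (Subgroup.mul_mem _ (Subgroup.inv_mem _ hf) hg) hxy.symm ?_ ?_
    · have := hfA x (notMem_halfTree_self x y)
      rw [RelIso.mul_apply, hgx]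
      conv_lhs => rw [← this, RelIso.inv_apply_self]
    · intro v hv
      rw [notMem_halfTree hT hxy.symm] at hv
      rw [RelIso.mul_apply, ← hfB v hv, RelIso.inv_apply_self]
  simpa using N.mul_mem h1 h2

/-- Two applications of `FlipsHalfTrees.of_normalizes` pass from `U(F)` to `U(F)⁺` and from there
to an arbitrary nontrivial normal subgroup of `U(F)⁺`. -/
theorem LegalLabelling.isSimpleGroup_plusSubgroup {d : ℕ} (l : LegalLabelling T d)
    (F : Subgroup (Equiv.Perm (Fin d))) (hT : T.IsTree)
    (hflip : FlipsHalfTrees (l.universalGroup F))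
    (hdeg : ∀ v, ∃ nb : Fin 3 → V, (∀ i, T.Adj v (nb i)) ∧ Function.Injective nb)
    (hne : plusSubgroup (l.universalGroup F) ≠ ⊥) :
    IsSimpleGroup (plusSubgroup (l.universalGroup F)) := by
  have hP : FlipsHalfTrees (plusSubgroup (l.universalGroup F)) :=
    hflip.of_normalizes hT hdeg hne fun _ hh _ hm => conj_mem_plusSubgroup hh hm
  have := (Subgroup.nontrivial_iff_ne_bot _).mpr hne
  refine ⟨fun N hN => or_iff_not_imp_left.mpr fun hbot => ?_⟩
  have hnorm : ∀ h ∈ plusSubgroup (l.universalGroup F),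
      ∀ n ∈ N.map (plusSubgroup (l.universalGroup F)).subtype,
        h⁻¹ * n * h ∈ N.map (plusSubgroup (l.universalGroup F)).subtype := by
    rintro h hh _ ⟨n, hn, rfl⟩
    refine ⟨_, hN.conj_mem n hn (⟨h, hh⟩⁻¹), ?_⟩
    simp
  have hle := Subgroup.map_subtype_le N
  have hflipN := hP.of_normalizes hT hdeg
    (by rwa [Ne, Subgroup.map_eq_bot_iff_of_injective _ (Subgroup.subtype_injective _)]) hnorm
  have := l.plusSubgroup_le_of_normalizes F hT hflipN hdeg
    (hle.trans (plusSubgroup_le _)) hnorm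
  rw [eq_top_iff]
  rintro ⟨g, hg⟩ -
  obtain ⟨g', hg', h⟩ := this hg
  exact (Subtype.ext h : g' = ⟨g, hg⟩) ▸ hg'

/-! ### Automorphisms with constant local permutation -/

namespace LegalLabelling

variable {d : ℕ} (l : LegalLabelling T d)

/-- The neighbour of `v` along the edge of colour `c`. -/
noncomputable def nbr (v : V) (c : Fin d) : V := ((l.atVertex v).symm c).1.snd

theorem adj_nbr (v : V) (c : Fin d) : T.Adj v (l.nbr v c) := by
  have h := ((l.atVertex v).symm c).1.adj
  rwa [((l.atVertex v).symm c).2] at h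

theorem label_nbr (v : V) (c : Fin d) : l.label ⟨(v, l.nbr v c), l.adj_nbr v c⟩ = c := by
  have h := (l.atVertex v).apply_symm_apply c
  refine Eq.trans (congrArg l.label ?_) h
  exact SimpleGraph.Dart.ext _ _ (Prod.ext ((l.atVertex v).symm c).2.symm rfl)

theorem nbr_label {v w : V} (h : T.Adj v w) : l.nbr v (l.label ⟨(v, w), h⟩) = w := by
  have := (l.atVertex v).symm_apply_apply ⟨⟨(v, w), h⟩, rfl⟩
  exact congrArg (fun e : EdgesFrom T v => e.1.snd) this

theorem exists_nbr_eq {v w : V} (h : T.Adj v w) : ∃ c, l.nbr v c = w :=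
  ⟨_, l.nbr_label h⟩

theorem nbr_injective (v : V) : Function.Injective (l.nbr v) := by
  intro c c' h
  rw [← l.label_nbr v c, ← l.label_nbr v c']
  congr 2
  rw [h]

theorem nbr_nbr (v : V) (c : Fin d) : l.nbr (l.nbr v c) c = v := by
  have h := l.label_symm ⟨(v, l.nbr v c), l.adj_nbr v c⟩
  rw [l.label_nbr] at h
  have := l.nbr_label (l.adj_nbr v c).symm
  rwa [show l.label ⟨(l.nbr v c, v), (l.adj_nbr v c).symm⟩ = c from h] at this

theorem map_nbr (g : T ≃g T) (v : V) (c : Fin d) :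
    g (l.nbr v c) = l.nbr (g v) (l.localPerm g v c) := by
  have h := l.localPerm_label g v ⟨⟨(v, l.nbr v c), l.adj_nbr v c⟩, rfl⟩
  rw [l.label_nbr] at h
  rw [h]
  exact (l.nbr_label _).symm

theorem localPerm_eq_of_map_nbr {g : T ≃g T} {v : V} {σ : Equiv.Perm (Fin d)}
    (h : ∀ c, g (l.nbr v c) = l.nbr (g v) (σ c)) : l.localPerm g v = σ :=
  Equiv.ext fun c => l.nbr_injective (g v) ((l.map_nbr g v c).symm.trans (h c))

/-- The endpoint of the walk from `y` whose colours are the images under `σ` of those of `p`. -/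
noncomputable def transport (σ : Equiv.Perm (Fin d)) (y : V) {x v : V} (p : T.Walk x v) : V :=
  p.darts.foldl (fun u e => l.nbr u (σ (l.label e))) y

theorem transport_concat (σ : Equiv.Perm (Fin d)) (y : V) {x v w : V} (p : T.Walk x v)
    (h : T.Adj v w) :
    l.transport σ y (p.concat h) = l.nbr (l.transport σ y p) (σ (l.label ⟨(v, w), h⟩)) := by
  simp [transport, SimpleGraph.Walk.darts_concat]

/-- A map of the tree that permutes all colours by `σ`, with a prescribed value at `x`. -/
theorem exists_map_nbr (hT : T.IsTree) (x y : V) (σ : Equiv.Perm (Fin d)) :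
    ∃ f : V → V, f x = y ∧ ∀ v c, f (l.nbr v c) = l.nbr (f v) (σ c) := by
  choose p hp using fun v => (hT.existsUnique_path x v).exists
  refine ⟨fun v => l.transport σ y (p v), ?_, fun v c => ?_⟩
  · have : p x = .nil := (hT.existsUnique_path x x).unique (hp x) .nil
    simp [this, transport]
  · have hadj := l.adj_nbr v c
    dsimp only
    by_cases hv : v ∈ (p (l.nbr v c)).support
    · rw [hT.isAcyclic.path_concat (hp v) (hp _) hadj hv, transport_concat, label_nbr]
    · have hw := hT.isAcyclic.mem_support_of_ne_mem_support_of_adj_of_isPath (hp v) (hp _)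
        hadj hv
      have hc := l.label_nbr (l.nbr v c) c
      simp only [l.nbr_nbr] at hc
      rw [hT.isAcyclic.path_concat (hp _) (hp v) hadj.symm hw, transport_concat, hc, nbr_nbr]

theorem eq_id_of_map_nbr (hT : T.IsTree) {f : V → V} {x : V} (hx : f x = x)
    (h : ∀ v c, f (l.nbr v c) = l.nbr (f v) c) (v : V) : f v = v := by
  obtain ⟨p⟩ := hT.connected v x
  induction p with
  | nil => exact hx
  | cons hadj _ ih =>
    obtain ⟨c, rfl⟩ := l.exists_nbr_eq hadj.symm
    rw [h, ih hx]

theorem exists_localPerm_eq (hT : T.IsTree) (x y : V) (σ : Equiv.Perm (Fin d)) :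
    ∃ g : T ≃g T, g x = y ∧ ∀ v, l.localPerm g v = σ := by
  obtain ⟨f, hfx, hf⟩ := l.exists_map_nbr hT x y σ
  obtain ⟨f', hfx', hf'⟩ := l.exists_map_nbr hT y x σ⁻¹
  have adj : ∀ (k : V → V) (τ : Equiv.Perm (Fin d)),
      (∀ v c, k (l.nbr v c) = l.nbr (k v) (τ c)) → ∀ v w, T.Adj v w → T.Adj (k v) (k w) := by
    intro k τ hk v w hvw
    obtain ⟨c, rfl⟩ := l.exists_nbr_eq hvw
    rw [hk]
    exact l.adj_nbr _ _
  have hl : Function.LeftInverse f' f :=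
    l.eq_id_of_map_nbr hT (f := f' ∘ f) (x := x) (by simp [hfx, hfx']) (by simp [hf, hf'])
  have hr : Function.LeftInverse f f' :=
    l.eq_id_of_map_nbr hT (f := f ∘ f') (x := y) (by simp [hfx, hfx']) (by simp [hf, hf'])
  let g : T ≃g T :=
    { toFun := f
      invFun := f'
      left_inv := hl
      right_inv := hr
      map_rel_iff' := by
        intro v w
        refine ⟨fun h => ?_, adj f σ hf v w⟩
        have := adj f' _ hf' _ _ h
        simp only [Equiv.coe_fn_mk] at this
        rwa [hl, hl] at this }
  exact ⟨g, hfx, fun v => l.localPerm_eq_of_map_nbr fun c => hf v c⟩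

/-- Every edge is inverted by a colour-preserving automorphism. -/
theorem exists_inversion (F : Subgroup (Equiv.Perm (Fin d))) (hT : T.IsTree) {x y : V}
    (hxy : T.Adj x y) : ∃ g ∈ l.universalGroup F, g x = y ∧ g y = x := by
  obtain ⟨g, hg, hp⟩ := l.exists_localPerm_eq hT x y 1
  refine ⟨g, fun v => hp v ▸ F.one_mem, hg, ?_⟩
  obtain ⟨c, rfl⟩ := l.exists_nbr_eq hxy
  rw [l.map_nbr, hp, hg, Equiv.Perm.one_apply, l.nbr_nbr]

theorem flipsHalfTrees_universalGroup (F : Subgroup (Equiv.Perm (Fin d))) (hT : T.IsTree) :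
    FlipsHalfTrees (l.universalGroup F) := by
  intro x y hxy
  obtain ⟨g, hg, hx, hy⟩ := l.exists_inversion F hT hxy
  refine ⟨g, hg, fun v hv => ?_⟩
  have := (map_mem_halfTree g).mpr hv
  rwa [hx, hy] at this

end LegalLabelling

/-! ### The parity of an automorphism -/

theorem even_dist_add (hT : T.IsTree) (a b c : V) :
    Even (T.dist a b + T.dist b c + T.dist a c) := by
  obtain ⟨p⟩ := hT.connected c b
  induction p with
  | nil => simp
  | @cons c c' b h _ ih =>
    have h1 := hT.dist_eq_dist_add_one_of_adj a h
    have h2 := hT.dist_eq_dist_add_one_of_adj b h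
    rw [Nat.even_iff] at *
    omega

theorem even_dist_iff (hT : T.IsTree) (a b c : V) :
    Even (T.dist a c) ↔ (Even (T.dist a b) ↔ Even (T.dist b c)) := by
  have := even_dist_add hT a b c
  simp only [Nat.even_iff] at *
  omega

theorem even_dist_map_mul_iff (hT : T.IsTree) (g h : T ≃g T) (v : V) :
    Even (T.dist v ((g * h) v)) ↔ (Even (T.dist v (g v)) ↔ Even (T.dist v (h v))) := by
  rw [even_dist_iff hT v (g v), RelIso.mul_apply, dist_map]

theorem even_dist_map_iff (hT : T.IsTree) (g : T ≃g T) (v w : V) :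
    Even (T.dist v (g v)) ↔ Even (T.dist w (g w)) := by
  have h1 := even_dist_iff hT v w (g v)
  have h2 := even_dist_iff hT w (g w) (g v)
  rw [dist_map, T.dist_comm (u := w) (v := v)] at h2
  tauto

theorem even_dist_of_mem_plusSubgroup (hT : T.IsTree) {G : Subgroup (T ≃g T)} {g : T ≃g T}
    (hg : g ∈ plusSubgroup G) (v : V) : Even (T.dist v (g v)) := by
  induction hg using Subgroup.closure_induction with
  | mem g hg =>
    obtain ⟨-, e, he⟩ := hg
    have : g e.fst = e.fst := congrArg (fun e : T.Dart => e.fst) he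
    rw [even_dist_map_iff hT g v e.fst, this, SimpleGraph.dist_self]
    exact Even.zero
  | one => simp
  | mul a b _ _ ha hb => exact (even_dist_map_mul_iff hT a b v).mpr (iff_of_true ha hb)
  | inv a _ ha =>
    have := even_dist_map_mul_iff hT a a⁻¹ v
    simpa [ha] using this

/-! ### The index of `U(F)⁺` -/

namespace LegalLabelling

variable {d : ℕ} (l : LegalLabelling T d)

/-- If `F` is generated by its point stabilizers, then `U(F)⁺` contains the vertex stabilizers of
`U(F)`: an element of `F` fixing the colour `i` is the local permutation at `x` of an element of
`U(F)` that fixes `x` and its edge of colour `i`. -/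
theorem mem_plusSubgroup_of_fixes (F : Subgroup (Equiv.Perm (Fin d))) (hT : T.IsTree)
    (hd : 0 < d) (hgen : (⨆ i : Fin d, MulAction.stabilizer F i) = ⊤) {x : V} {g : T ≃g T}
    (hg : g ∈ l.universalGroup F) (hgx : g x = x) : g ∈ plusSubgroup (l.universalGroup F) := by
  let K : Subgroup F :=
    { carrier := {σ | ∃ h ∈ plusSubgroup (l.universalGroup F), h x = x ∧ l.localPerm h x = σ}
      one_mem' := ⟨1, Subgroup.one_mem _, rfl, l.localPerm_one x⟩
      mul_mem' := by
        rintro σ τ ⟨a, ha, hax, hσ⟩ ⟨b, hb, hbx, hτ⟩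
        refine ⟨a * b, Subgroup.mul_mem _ ha hb, by rw [RelIso.mul_apply, hbx, hax], ?_⟩
        rw [l.localPerm_mul, hbx, hσ, hτ]
        rfl
      inv_mem' := by
        rintro σ ⟨a, ha, hax, hσ⟩
        have hax' : a⁻¹ x = x := by
          conv_lhs => rw [← hax, RelIso.inv_apply_self]
        refine ⟨a⁻¹, Subgroup.inv_mem _ ha, hax', ?_⟩
        have h := l.localPerm_mul a a⁻¹ x
        rw [mul_inv_cancel, localPerm_one, hax', hσ] at h
        exact eq_inv_of_mul_eq_one_right h.symm }
  have hK : (⨆ i : Fin d, MulAction.stabilizer F i) ≤ K := by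
    refine iSup_le fun i σ hσ => ?_
    obtain ⟨h, hx, hp⟩ := l.exists_localPerm_eq hT x x σ
    refine ⟨h, mem_plusSubgroup (fun v => hp v ▸ σ.2) (l.adj_nbr x i) hx ?_, hx, hp x⟩
    have hσi : (σ : Equiv.Perm (Fin d)) i = i := hσ
    rw [l.map_nbr, hp, hx, hσi]
  obtain ⟨h, hh, hx, hp⟩ : (⟨l.localPerm g x, hg x⟩ : F) ∈ K := hK (hgen ▸ Subgroup.mem_top _)
  have hx' : h⁻¹ x = x := by
    conv_lhs => rw [← hx, RelIso.inv_apply_self]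
  have hfix : ∀ c, (h⁻¹ * g) (l.nbr x c) = l.nbr x c := by
    intro c
    have : g (l.nbr x c) = h (l.nbr x c) := by
      rw [l.map_nbr, l.map_nbr, hgx, hx, hp]
    rw [RelIso.mul_apply, this, RelIso.inv_apply_self]
  have hmem : h⁻¹ * g ∈ plusSubgroup (l.universalGroup F) :=
    mem_plusSubgroup (Subgroup.mul_mem _ (Subgroup.inv_mem _ (plusSubgroup_le _ hh)) hg)
      (l.adj_nbr x ⟨0, hd⟩) (by rw [RelIso.mul_apply, hgx, hx']) (hfix _)
  simpa using Subgroup.mul_mem _ hh hmem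

/-- The orbit of `x` under `U(F)⁺` comes within distance one of every vertex: vertex stabilizers in
`U(F)⁺` are transitive on neighbours, so vertices at distance two lie in the same orbit. -/
theorem exists_map_eq_or_adj (F : Subgroup (Equiv.Perm (Fin d))) (hT : T.IsTree)
    (hd : 0 < d) (htr : MulAction.IsPretransitive F (Fin d))
    (hgen : (⨆ i : Fin d, MulAction.stabilizer F i) = ⊤) (x z : V) :
    ∃ h ∈ plusSubgroup (l.universalGroup F), h x = z ∨ T.Adj (h x) z := by
  obtain ⟨p⟩ := hT.connected z x
  induction p with
  | nil => exact ⟨1, Subgroup.one_mem _, .inl rfl⟩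
  | @cons z z' x hadj _ ih =>
    obtain ⟨h, hh, rfl | hx⟩ := ih
    · exact ⟨h, hh, .inr hadj.symm⟩
    · obtain ⟨a, ha⟩ := l.exists_nbr_eq hx.symm
      obtain ⟨b, rfl⟩ := l.exists_nbr_eq hadj.symm
      obtain ⟨σ, hσ⟩ := htr.exists_smul_eq a b
      replace hσ : (σ : Equiv.Perm (Fin d)) a = b := hσ
      obtain ⟨k, hk, hp⟩ := l.exists_localPerm_eq hT z' z' σ
      refine ⟨k * h, Subgroup.mul_mem _ (l.mem_plusSubgroup_of_fixes F hT hd hgen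
        (fun v => hp v ▸ σ.2) hk) hh, .inl ?_⟩
      rw [RelIso.mul_apply, ← ha, l.map_nbr, hk, hp, hσ]

theorem mem_plusSubgroup_of_even_dist (F : Subgroup (Equiv.Perm (Fin d))) (hT : T.IsTree)
    (hd : 0 < d) (htr : MulAction.IsPretransitive F (Fin d))
    (hgen : (⨆ i : Fin d, MulAction.stabilizer F i) = ⊤) {g : T ≃g T}
    (hg : g ∈ l.universalGroup F) {x : V} (hx : Even (T.dist x (g x))) :
    g ∈ plusSubgroup (l.universalGroup F) := by
  obtain ⟨h, hh, hgh | hgh⟩ := l.exists_map_eq_or_adj F hT hd htr hgen x (g x)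
  · have hmem : h⁻¹ * g ∈ plusSubgroup (l.universalGroup F) := by
      refine l.mem_plusSubgroup_of_fixes F hT hd hgen (x := x)
        (Subgroup.mul_mem _ (Subgroup.inv_mem _ (plusSubgroup_le _ hh)) hg) ?_
      rw [RelIso.mul_apply, ← hgh, RelIso.inv_apply_self]
    simpa using Subgroup.mul_mem _ hh hmem
  · -- Both `h x` and `g x` are at even distance from `x`, so they cannot be adjacent.
    have h1 := even_dist_of_mem_plusSubgroup hT hh x
    have h2 := (even_dist_iff hT x (h x) (g x)).mp hx
    rw [SimpleGraph.dist_eq_one_iff_adj.mpr hgh] at h2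
    exact absurd (h2.mp h1) (by decide)

end LegalLabelling

end BurgerMozes

theorem mainTheorem2 {V : Type*} (T : SimpleGraph V) [T.LocallyFinite] (hT : T.IsTree)
    (d : ℕ) (hd : 3 ≤ d) (hreg : T.IsRegularOfDegree d)
    (l : BurgerMozes.LegalLabelling T d) (F : Subgroup (Equiv.Perm (Fin d))) :
    (BurgerMozes.plusSubgroup (l.universalGroup F) = ⊥ ∨
      IsSimpleGroup (BurgerMozes.plusSubgroup (l.universalGroup F))) ∧
    (MulAction.IsPretransitive F (Fin d) → (⨆ i : Fin d, MulAction.stabilizer F i) = ⊤ →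
      BurgerMozes.plusSubgroup (l.universalGroup F) =
          l.universalGroup F ⊓ BurgerMozes.plusSubgroup (⊤ : Subgroup (T ≃g T)) ∧
        (BurgerMozes.plusSubgroup (l.universalGroup F)).relIndex (l.universalGroup F) = 2) := by
  constructor
  · refine or_iff_not_imp_left.mpr fun hne => ?_
    refine l.isSimpleGroup_plusSubgroup F hT (l.flipsHalfTrees_universalGroup F hT) ?_ hne
    exact fun v => ⟨fun i => l.nbr v (Fin.castLE hd i), fun i => l.adj_nbr v _,
      (l.nbr_injective v).comp (Fin.castLE_injective hd)⟩
  · intro htr hgen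
    have hd0 : 0 < d := by omega
    obtain ⟨x⟩ := hT.connected.nonempty
    constructor
    · refine le_antisymm (le_inf (BurgerMozes.plusSubgroup_le _) ?_) ?_
      · exact Subgroup.closure_mono fun g hg => ⟨Subgroup.mem_top g, hg.2⟩
      · rintro g ⟨hg, hg'⟩
        exact l.mem_plusSubgroup_of_even_dist F hT hd0 htr hgen hg
          (BurgerMozes.even_dist_of_mem_plusSubgroup hT hg' x)
    · -- An edge inversion represents the nontrivial coset.
      have hadj := l.adj_nbr x ⟨0, hd0⟩
      obtain ⟨a, ha, hax, -⟩ := l.exists_inversion F hT hadj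
      have hodd : ¬ Even (T.dist x (a x)) := by
        rw [hax, SimpleGraph.dist_eq_one_iff_adj.mpr hadj]
        decide
      refine Subgroup.relIndex_eq_two_iff_exists_notMem_and.mpr ⟨a, ha, fun h =>
        hodd (BurgerMozes.even_dist_of_mem_plusSubgroup hT h x), fun b hb => ?_⟩
      by_cases hbx : Even (T.dist x (b x))
      · exact .inr (l.mem_plusSubgroup_of_even_dist F hT hd0 htr hgen hb hbx)
      · refine .inl (l.mem_plusSubgroup_of_even_dist F hT hd0 htr hgen
          (Subgroup.mul_mem _ hb ha) (x := x) ?_)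
        exact (BurgerMozes.even_dist_map_mul_iff hT b a x).mpr (iff_of_false hbx hodd)
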